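/- Let $E$ be a complex Banach space, $E_{\mathbb R}$ its underlying real Banach space, and $(E_{\mathbb R})^*$ the dual of $E_{\mathbb R}$. Let $\mathrm{FBL}[E_{\mathbb R}]$ be the smallest closed vector sublattice, containing all evaluations $\delta_{E_{\mathbb R}}(x):x^*\mapsto x^*(x)$ ($x\in E$), of the Banach lattice of positively homogeneous functions $f:(E_{\mathbb R})^*\to\mathbb R$ (with the pointwise order) for which $$\|f\|_{\mathrm{FBL}[E_{\mathbb R}]}=\sup\Big\{\sum_{i=1}^n|f(x_i^*)|:\ n\in\mathbb N,\ x_1^*,\dots,x_n^*\in (E_{\mathbb R})^*,\ \sup_{\|x\|\le1}\sum_{i=1}^n|x_i^*(x)|\le1\Big\}<\infty .$$ The free complex Banach lattice is $\mathrm{FBL}_{\mathbb C}[E]=\mathrm{FBL}[E_{\mathbb R}]\oplus i\,\mathrm{FBL}[E_{\mathbb R}]$, regarded as a space of complex-valued functions on $(E_{\mathbb R})^*$, with the norm $$\|h\|=\sup\Big\{\sum_{j=1}^m|h(\mathrm{Re}\,z_j^*)|:\ m\in\mathbb N,\ z_1^*,\dots,z_m^*\in E^*,\ \sup_{\|z\|\le1}\sum_{j=1}^m|z_j^*(z)|\le1\Big\},$$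 and with the $\mathbb C$-linear map $\delta_E:E\to\mathrm{FBL}_{\mathbb C}[E]$, $\delta_E(z)=\delta_{E_{\mathbb R}}(z)-i\,\delta_{E_{\mathbb R}}(iz)$. A lattice homomorphism of $\mathrm{FBL}_{\mathbb C}[E]$ is a bounded operator of the form $f+ig\mapsto Sf+iSg$ with $S$ a real-linear lattice homomorphism of $\mathrm{FBL}[E_{\mathbb R}]$. For a bounded linear operator $T$ on a complex normed space, $\sigma(T)$ is its spectrum, $\sigma_p(T)$ the set of its eigenvalues, $\sigma_a(T)$ the set of $\lambda\in\sigma(T)$ such that $\lambda-T$ is not bounded below, and $r(T)=\sup\{|\lambda|:\lambda\in\sigma(T)\}$ (with $r(T)=0$ if $\sigma(T)=\emptyset$). Let $T:E\to E$ be a bounded $\mathbb C$-linear operator. There is a unique lattice homomorphism $\overline T:\mathrm{FBL}_{\mathbb C}[E]\to\mathrm{FBL}_{\mathbb C}[E]$ with $\overline T\circ\delta_E=\delta_E\circ T$; it satisfies $\|\overline T\|=\|T\|$, and: 1. $\sigma_a(T)\subset\sigma_a(\overline T)$ and $\sigma_p(T)\subset\sigma_p(\overline T)$; 2. $0\in\sigma(T)$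 if and only if $0\in\sigma(\overline T)$; 3. $r(\overline T)=r(T)$. -/

import Mathlib

open scoped ENNReal

noncomputable section

namespace FreeBanachLattice

section Real

variable (X : Type*) [NormedAddCommGroup X] [NormedSpace ℝ X]

/-- The (possibly infinite) quantity `‖f‖_{FBL[X]}` of a function `f : X* → ℝ`: the supremum of
`∑ |f (x_i*)|` over all finite families in `X*` with `sup_{x ∈ B_X} ∑ |x_i* x| ≤ 1`. -/
def realENorm (f : StrongDual ℝ X → ℝ) : ℝ≥0∞ :=
  ⨆ (n : ℕ) (x : Fin n → StrongDual ℝ X) (_ : ∀ v : X, ‖v‖ ≤ 1 → ∑ i, |x i v| ≤ 1),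
    ∑ i, ‖f (x i)‖ₑ

variable {X}

theorem sum_le_realENorm (f : StrongDual ℝ X → ℝ) {n : ℕ} (x : Fin n → StrongDual ℝ X)
    (hx : ∀ v : X, ‖v‖ ≤ 1 → ∑ i, |x i v| ≤ 1) : ∑ i, ‖f (x i)‖ₑ ≤ realENorm X f :=
  le_iSup_of_le n (le_iSup_of_le x (le_iSup_of_le hx le_rfl))

theorem realENorm_le {f : StrongDual ℝ X → ℝ} {C : ℝ≥0∞}
    (h : ∀ (n : ℕ) (x : Fin n → StrongDual ℝ X), (∀ v : X, ‖v‖ ≤ 1 → ∑ i, |x i v| ≤ 1) →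
      ∑ i, ‖f (x i)‖ₑ ≤ C) : realENorm X f ≤ C :=
  iSup_le fun n => iSup_le fun x => iSup_le fun hx => h n x hx

theorem realENorm_add_le (f g : StrongDual ℝ X → ℝ) :
    realENorm X (f + g) ≤ realENorm X f + realENorm X g := by
  refine realENorm_le fun n x hx => ?_
  calc ∑ i, ‖(f + g) (x i)‖ₑ ≤ ∑ i, (‖f (x i)‖ₑ + ‖g (x i)‖ₑ) :=
        Finset.sum_le_sum fun i _ => enorm_add_le _ _
    _ = _ := Finset.sum_add_distrib
    _ ≤ _ := add_le_add (sum_le_realENorm f x hx) (sum_le_realENorm g x hx)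

theorem realENorm_smul_le (c : ℝ) (f : StrongDual ℝ X → ℝ) :
    realENorm X (c • f) ≤ ‖c‖ₑ * realENorm X f := by
  refine realENorm_le fun n x hx => ?_
  calc ∑ i, ‖(c • f) (x i)‖ₑ = ‖c‖ₑ * ∑ i, ‖f (x i)‖ₑ := by
        simp [Finset.mul_sum, enorm_mul]
    _ ≤ _ := by gcongr; exact sum_le_realENorm f x hx

theorem realENorm_sup_le (f g : StrongDual ℝ X → ℝ) :
    realENorm X (f ⊔ g) ≤ realENorm X f + realENorm X g := by
  refine realENorm_le fun n x hx => ?_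
  calc ∑ i, ‖(f ⊔ g) (x i)‖ₑ ≤ ∑ i, (‖f (x i)‖ₑ + ‖g (x i)‖ₑ) := by
        refine Finset.sum_le_sum fun i _ => ?_
        rcases max_choice (f (x i)) (g (x i)) with h | h
        · simp [h]
        · simp [h]
    _ = _ := Finset.sum_add_distrib
    _ ≤ _ := add_le_add (sum_le_realENorm f x hx) (sum_le_realENorm g x hx)

variable (X)

/-- `H₁[X]`: the positively homogeneous functions `f : X* → ℝ` with `‖f‖_{FBL[X]} < ∞`. -/
def H₁ : Submodule ℝ (StrongDual ℝ X → ℝ) where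
  carrier := {f | (∀ c : ℝ, 0 ≤ c → ∀ x, f (c • x) = c * f x) ∧ realENorm X f < ∞}
  add_mem' := by
    rintro f g ⟨hf, hf'⟩ ⟨hg, hg'⟩
    refine ⟨fun c hc x => ?_, (realENorm_add_le f g).trans_lt (ENNReal.add_lt_top.2 ⟨hf', hg'⟩)⟩
    simp [hf c hc, hg c hc, mul_add]
  zero_mem' := by
    refine ⟨fun c hc x => by simp, lt_of_le_of_lt (realENorm_le (C := 0) ?_) (by simp)⟩
    intro n x hx
    simp
  smul_mem' := by
    rintro c f ⟨hf, hf'⟩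
    refine ⟨fun d hd x => ?_,
      (realENorm_smul_le c f).trans_lt (ENNReal.mul_lt_top enorm_lt_top hf')⟩
    simp [hf d hd, mul_left_comm]

variable {X}

/-- The evaluation function `δ_x : X* → ℝ`, `δ_x(x*) = x*(x)`. -/
def evalFn (x : X) : StrongDual ℝ X → ℝ := fun φ => φ x

/-- `S` is a norm-closed vector sublattice of `H₁[X]` (with the pointwise order). -/
structure IsClosedSublattice (S : Submodule ℝ (StrongDual ℝ X → ℝ)) : Prop where
  le_H₁ : S ≤ H₁ X
  sup_mem : ∀ f ∈ S, ∀ g ∈ S, f ⊔ g ∈ S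
  closed : ∀ f ∈ H₁ X, (∀ ε : ℝ≥0∞, 0 < ε → ∃ g ∈ S, realENorm X (f - g) < ε) → f ∈ S

variable (X)

/-- The real free Banach lattice `FBL[X]`: the smallest closed sublattice of `H₁[X]` containing
all the evaluation functions. -/
def FBL : Submodule ℝ (StrongDual ℝ X → ℝ) :=
  sInf {S | IsClosedSublattice S ∧ ∀ x : X, evalFn x ∈ S}

variable {X}

theorem evalFn_mem_H₁ (x : X) : evalFn x ∈ H₁ X := by
  refine ⟨fun c _ φ => by simp [evalFn], ?_⟩
  refine lt_of_le_of_lt (realENorm_le (C := ENNReal.ofReal ‖x‖) ?_) ENNReal.ofReal_lt_top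
  intro n y hy
  have key : ∑ i, |y i x| ≤ ‖x‖ := by
    rcases eq_or_ne x 0 with rfl | hx
    · simp
    have hx' : 0 < ‖x‖ := norm_pos_iff.2 hx
    have h := hy (‖x‖⁻¹ • x) (by rw [norm_smul, norm_inv, norm_norm, inv_mul_cancel₀ hx'.ne'])
    simp only [map_smul, smul_eq_mul, abs_mul, ← Finset.mul_sum, abs_inv, abs_norm] at h
    rwa [inv_mul_le_iff₀ hx', mul_one] at h
  calc ∑ i, ‖evalFn x (y i)‖ₑ = ENNReal.ofReal (∑ i, |y i x|) := by
        rw [ENNReal.ofReal_sum_of_nonneg fun i _ => abs_nonneg _]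
        simp [evalFn, Real.enorm_eq_ofReal_abs]
    _ ≤ _ := ENNReal.ofReal_le_ofReal key

theorem isClosedSublattice_H₁ : IsClosedSublattice (H₁ X) where
  le_H₁ := le_rfl
  sup_mem := by
    rintro f ⟨hf, hf'⟩ g ⟨hg, hg'⟩
    refine ⟨fun c hc x => ?_, (realENorm_sup_le f g).trans_lt (ENNReal.add_lt_top.2 ⟨hf', hg'⟩)⟩
    simp [hf c hc, hg c hc, mul_max_of_nonneg _ _ hc]
  closed := fun f hf _ => hf

theorem isClosedSublattice_FBL : IsClosedSublattice (FBL X) where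
  le_H₁ := sInf_le ⟨isClosedSublattice_H₁, evalFn_mem_H₁⟩
  sup_mem := by
    intro f hf g hg
    simp only [FBL, Submodule.mem_sInf, Set.mem_ofPred_eq] at hf hg ⊢
    exact fun S hS => hS.1.sup_mem f (hf S hS) g (hg S hS)
  closed := by
    intro f hf h
    simp only [FBL, Submodule.mem_sInf, Set.mem_ofPred_eq] at h ⊢
    intro S hS
    refine hS.1.closed f hf fun ε hε => ?_
    obtain ⟨g, hg, hg'⟩ := h ε hε
    exact ⟨g, hg S hS, hg'⟩

theorem evalFn_mem_FBL (x : X) : evalFn x ∈ FBL X := by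
  simp only [FBL, Submodule.mem_sInf, Set.mem_ofPred_eq]
  exact fun S hS => hS.2 x

/-- `FBL[X]` is a vector lattice for the pointwise order. -/
instance : Lattice (FBL X) :=
  Subtype.lattice (fun {f g} hf hg => isClosedSublattice_FBL.sup_mem f hf g hg)
    (fun {f g} hf hg => by
      have h := (FBL X).neg_mem (isClosedSublattice_FBL.sup_mem (-f) ((FBL X).neg_mem hf) (-g)
        ((FBL X).neg_mem hg))
      have e : -(-f ⊔ -g) = f ⊓ g := by
        rw [neg_sup, neg_neg, neg_neg]
      rwa [e] at h)

end Real

section Complex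

variable {E : Type*} [NormedAddCommGroup E] [NormedSpace ℂ E]

/-- The real part `Re z* ∈ (E_ℝ)*` of a functional `z* ∈ E*`. -/
def rePart (z : StrongDual ℂ E) : StrongDual ℝ E :=
  Complex.reCLM.comp (z.restrictScalars ℝ)

/-- The (possibly infinite) quantity `‖h‖_{FBL_ℂ[E]}` of a function `h : (E_ℝ)* → ℂ`: the supremum
of `∑ |h (Re z_j*)|` over all finite families in `E*` with `sup_{z ∈ B_E} ∑ |z_j* z| ≤ 1`. -/
def complexENorm (h : StrongDual ℝ E → ℂ) : ℝ≥0∞ :=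
  ⨆ (m : ℕ) (z : Fin m → StrongDual ℂ E) (_ : ∀ v : E, ‖v‖ ≤ 1 → ∑ j, ‖z j v‖ ≤ 1),
    ∑ j, ‖h (rePart (z j))‖ₑ

theorem sum_le_complexENorm (h : StrongDual ℝ E → ℂ) {m : ℕ} (z : Fin m → StrongDual ℂ E)
    (hz : ∀ v : E, ‖v‖ ≤ 1 → ∑ j, ‖z j v‖ ≤ 1) :
    ∑ j, ‖h (rePart (z j))‖ₑ ≤ complexENorm h :=
  le_iSup_of_le m (le_iSup_of_le z (le_iSup_of_le hz le_rfl))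

theorem complexENorm_le {h : StrongDual ℝ E → ℂ} {C : ℝ≥0∞}
    (H : ∀ (m : ℕ) (z : Fin m → StrongDual ℂ E), (∀ v : E, ‖v‖ ≤ 1 → ∑ j, ‖z j v‖ ≤ 1) →
      ∑ j, ‖h (rePart (z j))‖ₑ ≤ C) : complexENorm h ≤ C :=
  iSup_le fun m => iSup_le fun z => iSup_le fun hz => H m z hz

theorem complexENorm_add_le (f g : StrongDual ℝ E → ℂ) :
    complexENorm (f + g) ≤ complexENorm f + complexENorm g := by
  refine complexENorm_le fun n x hx => ?_
  calc ∑ i, ‖(f + g) (rePart (x i))‖ₑ ≤ ∑ i, (‖f (rePart (x i))‖ₑ + ‖g (rePart (x i))‖ₑ) :=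
        Finset.sum_le_sum fun i _ => enorm_add_le _ _
    _ = _ := Finset.sum_add_distrib
    _ ≤ _ := add_le_add (sum_le_complexENorm f x hx) (sum_le_complexENorm g x hx)

theorem complexENorm_smul (c : ℂ) (f : StrongDual ℝ E → ℂ) :
    complexENorm (c • f) = ‖c‖ₑ * complexENorm f := by
  simp only [complexENorm, ENNReal.mul_iSup, Pi.smul_apply, smul_eq_mul, enorm_mul,
    Finset.mul_sum]

/-- A function whose real and imaginary parts lie in `FBL[E_ℝ]` has finite norm. -/
theorem complexENorm_lt_top {h : StrongDual ℝ E → ℂ} (h₁ : (fun φ => (h φ).re) ∈ FBL E)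
    (h₂ : (fun φ => (h φ).im) ∈ FBL E) : complexENorm h < ∞ := by
  have f₁ := (isClosedSublattice_FBL.le_H₁ h₁).2
  have f₂ := (isClosedSublattice_FBL.le_H₁ h₂).2
  refine lt_of_le_of_lt (complexENorm_le fun m z hz => ?_) (ENNReal.add_lt_top.2 ⟨f₁, f₂⟩)
  have hz' : ∀ v : E, ‖v‖ ≤ 1 → ∑ j, |rePart (z j) v| ≤ 1 := fun v hv =>
    (Finset.sum_le_sum fun j _ => Complex.abs_re_le_norm (z j v)).trans (hz v hv)
  refine le_trans ?_ (add_le_add (sum_le_realENorm _ _ hz') (sum_le_realENorm _ _ hz'))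
  rw [← Finset.sum_add_distrib]
  refine Finset.sum_le_sum fun j _ => ?_
  simp only [← ofReal_norm]
  rw [← ENNReal.ofReal_add (norm_nonneg _) (norm_nonneg _)]
  exact ENNReal.ofReal_le_ofReal (Complex.norm_le_abs_re_add_abs_im _)

theorem rePart_surjective_scaled (φ : StrongDual ℝ E) :
    ∃ (c : ℝ) (z : StrongDual ℂ E), 0 ≤ c ∧ (∀ v : E, ‖v‖ ≤ 1 → ‖z v‖ ≤ 1) ∧
      φ = c • rePart z := by
  let w : StrongDual ℂ E := StrongDual.extendRCLike φ
  have hw : rePart w = φ := by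
    ext v
    exact StrongDual.re_extendRCLike_apply (𝕜 := ℂ) φ v
  have hc : (0 : ℝ) < ‖w‖ + 1 := by positivity
  refine ⟨‖w‖ + 1, ((‖w‖ + 1 : ℝ)⁻¹ : ℂ) • w, hc.le, fun v hv => ?_, ?_⟩
  · have h1 : ‖w v‖ ≤ ‖w‖ + 1 := by
      have := w.le_opNorm v
      nlinarith [norm_nonneg w]
    have h2 : ‖(((‖w‖ + 1 : ℝ) : ℂ))⁻¹‖ = (‖w‖ + 1)⁻¹ := by
      rw [norm_inv, Complex.norm_real, Real.norm_of_nonneg hc.le]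
    rw [_root_.smul_apply, norm_smul, h2]
    rwa [inv_mul_le_iff₀ hc, mul_one]
  · ext v
    have hv : φ v = (w v).re := by rw [← hw]; rfl
    have : (rePart ((((‖w‖ + 1 : ℝ) : ℂ))⁻¹ • w)) v = (‖w‖ + 1)⁻¹ * (w v).re := by
      simp only [rePart, ContinuousLinearMap.comp_apply,
        ContinuousLinearMap.coe_restrictScalars', _root_.smul_apply, smul_eq_mul,
        Complex.reCLM_apply]
      rw [← Complex.ofReal_inv, Complex.re_ofReal_mul]
    rw [_root_.smul_apply, this, hv, smul_eq_mul, mul_inv_cancel_left₀ hc.ne']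

variable (E)

/-- `FBL[E_ℝ] ⊕ i FBL[E_ℝ]`, realized as the space of functions `f + i g : (E_ℝ)* → ℂ` with
`f, g ∈ FBL[E_ℝ]`. -/
def FBLCsub : Submodule ℂ (StrongDual ℝ E → ℂ) where
  carrier := {h | (fun φ => (h φ).re) ∈ FBL E ∧ (fun φ => (h φ).im) ∈ FBL E}
  add_mem' := fun {f g} hf hg => ⟨(FBL E).add_mem hf.1 hg.1, (FBL E).add_mem hf.2 hg.2⟩
  zero_mem' := ⟨(FBL E).zero_mem, (FBL E).zero_mem⟩
  smul_mem' := fun c f hf => by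
    constructor
    · have := (FBL E).sub_mem ((FBL E).smul_mem c.re hf.1) ((FBL E).smul_mem c.im hf.2)
      exact this
    · have := (FBL E).add_mem ((FBL E).smul_mem c.re hf.2) ((FBL E).smul_mem c.im hf.1)
      exact this

/-- The free complex Banach lattice `FBL_ℂ[E]`; its norm is given below. (It is a separate type,
so that it does not inherit the topology of pointwise convergence.) -/
def FBLC : Type _ := FBLCsub E

variable {E}

namespace FBLC

instance : AddCommGroup (FBLC E) := inferInstanceAs (AddCommGroup (FBLCsub E))

instance : Module ℂ (FBLC E) := inferInstanceAs (Module ℂ (FBLCsub E))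

/-- An element of `FBL_ℂ[E]` as a function `(E_ℝ)* → ℂ`. -/
def toFun (h : FBLC E) : StrongDual ℝ E → ℂ := Subtype.val (p := (· ∈ FBLCsub E)) h

theorem toFun_injective : Function.Injective (toFun (E := E)) := Subtype.val_injective

theorem enorm_lt_top (h : FBLC E) : complexENorm h.toFun < ∞ :=
  complexENorm_lt_top h.2.1 h.2.2

theorem eq_zero_of_complexENorm (h : FBLC E) (h0 : complexENorm h.toFun = 0) : h = 0 := by
  apply toFun_injective
  funext φ
  obtain ⟨c, z, hc, hz, rfl⟩ := rePart_surjective_scaled φ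
  have h1 := sum_le_complexENorm h.toFun (fun _ : Fin 1 => z) (by simpa using hz)
  rw [h0] at h1
  have h2 : h.toFun (rePart z) = 0 := by simpa using h1
  have hr := (isClosedSublattice_FBL.le_H₁ h.2.1).1 c hc (rePart z)
  have hi := (isClosedSublattice_FBL.le_H₁ h.2.2).1 c hc (rePart z)
  change (h.toFun (c • rePart z)).re = c * (h.toFun (rePart z)).re at hr
  change (h.toFun (c • rePart z)).im = c * (h.toFun (rePart z)).im at hi
  rw [h2] at hr hi
  change h.toFun (c • rePart z) = 0
  apply Complex.ext
  · simpa using hr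
  · simpa using hi

/-- The norm of `FBL_ℂ[E]`. -/
instance : Norm (FBLC E) := ⟨fun h => (complexENorm h.toFun).toReal⟩

theorem norm_def (h : FBLC E) : ‖h‖ = (complexENorm h.toFun).toReal := rfl

theorem core : NormedSpace.Core ℂ (FBLC E) where
  norm_nonneg _ := ENNReal.toReal_nonneg
  norm_smul c h := by
    have : complexENorm (c • h).toFun = ‖c‖ₑ * complexENorm h.toFun := complexENorm_smul c h.toFun
    simp [norm_def, this, ENNReal.toReal_mul]
  norm_triangle f g := by
    rw [norm_def, norm_def, norm_def,
      ← ENNReal.toReal_add (enorm_lt_top f).ne (enorm_lt_top g).ne]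
    exact ENNReal.toReal_mono (ENNReal.add_lt_top.2 ⟨enorm_lt_top f, enorm_lt_top g⟩).ne
      (complexENorm_add_le f.toFun g.toFun)
  norm_eq_zero_iff h := by
    constructor
    · intro h0
      rw [norm_def, ENNReal.toReal_eq_zero_iff] at h0
      exact eq_zero_of_complexENorm h (h0.resolve_right (enorm_lt_top h).ne)
    · rintro rfl
      have : complexENorm ((0 : ℂ) • (0 : FBLC E)).toFun = 0 := by
        rw [show ((0 : ℂ) • (0 : FBLC E)).toFun = (0 : ℂ) • (0 : FBLC E).toFun from rfl,
          complexENorm_smul]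
        simp
      rw [smul_zero] at this
      simp [norm_def, this]

instance : NormedAddCommGroup (FBLC E) := NormedAddCommGroup.ofCore core

instance : NormedSpace ℂ (FBLC E) := NormedSpace.ofCore core

/-- The element `f + i g` of `FBL_ℂ[E]`, for `f, g ∈ FBL[E_ℝ]`. -/
def mk (f g : FBL E) : FBLC E :=
  ⟨fun φ => ⟨f.1 φ, g.1 φ⟩, f.2, g.2⟩

/-- The canonical embedding `δ_E(z) = δ_{E_ℝ}(z) - i δ_{E_ℝ}(i z)`. -/
def delta : E →ₗ[ℂ] FBLC E where
  toFun z := mk ⟨evalFn z, evalFn_mem_FBL z⟩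
    (-⟨evalFn (Complex.I • z), evalFn_mem_FBL (Complex.I • z)⟩)
  map_add' z w := by
    apply toFun_injective
    funext φ
    apply Complex.ext
    · change φ (z + w) = φ z + φ w
      simp
    · change -φ (Complex.I • (z + w)) = -φ (Complex.I • z) + -φ (Complex.I • w)
      rw [smul_add, map_add, neg_add]
  map_smul' c z := by
    have hcz : c • z = c.re • z + c.im • (Complex.I • z) := by
      conv_lhs => rw [← Complex.re_add_im c, add_smul, mul_smul, Complex.coe_smul,
        Complex.coe_smul]
    have hci : Complex.I • (c • z) = c.re • (Complex.I • z) - c.im • z := by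
      rw [hcz, smul_add, smul_comm, smul_comm Complex.I c.im, smul_smul, Complex.I_mul_I,
        neg_one_smul, smul_neg, sub_eq_add_neg]
    apply toFun_injective
    funext φ
    apply Complex.ext
    · change φ (c • z) = c.re * φ z - c.im * -φ (Complex.I • z)
      rw [hcz, map_add, map_smul, map_smul, smul_eq_mul, smul_eq_mul]
      ring
    · change -φ (Complex.I • (c • z)) = c.re * -φ (Complex.I • z) + c.im * φ z
      rw [hci, map_sub, φ.map_smul, φ.map_smul, smul_eq_mul, smul_eq_mul]
      ring

/-- An operator on `FBL_ℂ[E]` is a (complex) lattice homomorphism if it is the complexification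
`f + i g ↦ S f + i S g` of a real-linear lattice homomorphism `S` of `FBL[E_ℝ]`. -/
def IsLatticeHom (R : FBLC E →L[ℂ] FBLC E) : Prop :=
  ∃ S : FBL E →ₗ[ℝ] FBL E,
    (∀ f g, S (f ⊔ g) = S f ⊔ S g) ∧ (∀ f g, S (f ⊓ g) = S f ⊓ S g) ∧
    ∀ f g, R (mk f g) = mk (S f) (S g)

/-- `R` is a lattice homomorphism of `FBL_ℂ[E]` extending `T`, that is, `R ∘ δ_E = δ_E ∘ T`. -/
def IsInduced (T : E →L[ℂ] E) (R : FBLC E →L[ℂ] FBLC E) : Prop :=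
  IsLatticeHom R ∧ ∀ z : E, R (delta z) = delta (T z)

end FBLC

end Complex

section Spectrum

variable {V : Type*} [NormedAddCommGroup V] [NormedSpace ℂ V]

/-- The point spectrum `σ_p(T)`: the set of eigenvalues. -/
def pointSpectrum (T : V →L[ℂ] V) : Set ℂ :=
  {μ | Module.End.HasEigenvalue (T : V →ₗ[ℂ] V) μ}

/-- The approximate point spectrum `σ_a(T)`: those `μ ∈ σ(T)` for which `μ - T` is not bounded
below. -/
def approxPointSpectrum (T : V →L[ℂ] V) : Set ℂ :=
  {μ | μ ∈ spectrum ℂ T ∧ ¬ ∃ α : ℝ, 0 < α ∧ ∀ v : V, α * ‖v‖ ≤ ‖μ • v - T v‖}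

end Spectrum

end FreeBanachLattice

end

/-!
Pulling back along the adjoint, `f ↦ f ∘ T*`, multiplies weak `1`-norms by at most `‖T‖`, so it
maps `FBL[X]` into `FBL[Y]`; on `FBL_ℂ[E]` it gives `T̄`, with `‖T̄‖ ≤ ‖T‖`. Two lattice
homomorphisms which agree on the range of `δ_E` agree on a closed sublattice, hence everywhere.

The map `δ_E` is an isometry intertwining `T` and `T̄`, which yields `‖T‖ ≤ ‖T̄‖` and the inclusions
of the point spectra. As `T ↦ T̄` is multiplicative and isometric, the spectral radii agree by
Gelfand's formula; this uses that `FBL_ℂ[E]` is complete. Finally, if `T̄` is invertible then `T` is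
bounded below, and its range is dense: every function in the range of `T̄` vanishes at `Re w`
whenever `w ∘ T = 0`, whereas `(δ_E v)(Re w) = w v`.
-/

open scoped ENNReal Topology
open Filter

noncomputable section

namespace FreeBanachLattice

section Operators

variable {V W : Type*} [NormedAddCommGroup V] [NormedSpace ℂ V] [NormedAddCommGroup W]
  [NormedSpace ℂ W]

theorem mem_approxPointSpectrum_iff {A : V →L[ℂ] V} {μ : ℂ} :
    μ ∈ approxPointSpectrum A ↔ ¬ ∃ α : ℝ, 0 < α ∧ ∀ v, α * ‖v‖ ≤ ‖μ • v - A v‖ := by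
  refine and_iff_right_of_imp fun hbelow hunit => hbelow ?_
  obtain ⟨u, hu⟩ := hunit
  have hu_apply (v : V) : ContinuousLinearEquiv.unitsEquiv ℂ V u v = μ • v - A v :=
    DFunLike.congr_fun hu v
  simpa only [hu_apply] using antilipschitzWith_iff_exists_mul_le_norm.1
    ⟨_, (ContinuousLinearEquiv.unitsEquiv ℂ V u).antilipschitz⟩

theorem approxPointSpectrum_subset {A : V →L[ℂ] V} {B : W →L[ℂ] W} (J : V →ₗᵢ[ℂ] W)
    (hJ : ∀ v, B (J v) = J (A v)) : approxPointSpectrum A ⊆ approxPointSpectrum B := by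
  intro μ hμ
  rw [mem_approxPointSpectrum_iff] at hμ ⊢
  rintro ⟨α, hα, hbelow⟩
  refine hμ ⟨α, hα, fun v => ?_⟩
  simpa only [hJ, ← map_smul, ← map_sub, J.norm_map] using hbelow (J v)

theorem pointSpectrum_subset {A : V →L[ℂ] V} {B : W →L[ℂ] W} {J : V →ₗ[ℂ] W}
    (hinj : Function.Injective J) (hJ : ∀ v, B (J v) = J (A v)) :
    pointSpectrum A ⊆ pointSpectrum B := by
  intro μ hμ
  obtain ⟨v, hv⟩ := Module.End.HasEigenvalue.exists_hasEigenvector hμ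
  have hAv : A v = μ • v := hv.apply_eq_smul
  have hBJv : B (J v) = μ • J v := by rw [hJ, hAv, map_smul]
  exact Module.End.hasEigenvalue_of_hasEigenvector
    ⟨Module.End.mem_eigenspace_iff.2 hBJv, (map_ne_zero_iff J hinj).2 hv.2⟩

theorem spectralRadius_map_of_norm_map {A B : Type*} [NormedRing A] [NormedAlgebra ℂ A]
    [CompleteSpace A] [NormedRing B] [NormedAlgebra ℂ B] [CompleteSpace B] {φ : A →* B}
    (hφ : ∀ a, ‖φ a‖ = ‖a‖) (a : A) : spectralRadius ℂ (φ a) = spectralRadius ℂ a := by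
  have hpow (n : ℕ) : ‖φ a ^ n‖₊ = ‖a ^ n‖₊ := by
    rw [← map_pow]
    exact NNReal.eq (hφ _)
  have hlim := spectrum.pow_nnnorm_pow_one_div_tendsto_nhds_spectralRadius (φ a)
  simp only [hpow] at hlim
  exact tendsto_nhds_unique hlim
    (spectrum.pow_nnnorm_pow_one_div_tendsto_nhds_spectralRadius a)

theorem topologicalClosure_eq_top_of_forall_dual {𝕜 Z : Type*} [RCLike 𝕜]
    [NormedAddCommGroup Z] [NormedSpace 𝕜 Z] {p : Submodule 𝕜 Z}
    (hp : ∀ w : StrongDual 𝕜 Z, (∀ x ∈ p, w x = 0) → w = 0) : p.topologicalClosure = ⊤ := by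
  by_contra hne
  obtain ⟨v, -, hv⟩ := SetLike.exists_of_lt (Ne.lt_top hne)
  have : IsClosed (p.topologicalClosure : Set Z) := p.isClosed_topologicalClosure
  let π := p.topologicalClosure.mkQL
  have hπ {x : Z} : π x = 0 ↔ x ∈ p.topologicalClosure := Submodule.Quotient.mk_eq_zero _
  obtain ⟨g, hg⟩ := SeparatingDual.exists_ne_zero (R := 𝕜) (mt hπ.1 hv)
  have hgπ : g.comp π = 0 := hp _ fun x hx => by
    rw [ContinuousLinearMap.comp_apply, hπ.2 (p.le_topologicalClosure hx), map_zero]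
  exact hg (DFunLike.congr_fun hgπ v)

end Operators

section WeakOneNorm

/-- Positive homogeneity, with respect to real scalars. -/
def PosHomogeneous {V W : Type*} [SMul ℝ V] [SMul ℝ W] (f : V → W) : Prop :=
  ∀ c : ℝ, 0 ≤ c → ∀ v, f (c • v) = c • f v

theorem isClosed_setOf_posHomogeneous {V W : Type*} [SMul ℝ V] [SMul ℝ W] [TopologicalSpace W]
    [T2Space W] [ContinuousConstSMul ℝ W] : IsClosed {f : V → W | PosHomogeneous f} := by
  simp only [PosHomogeneous, Set.ofPred_forall]
  exact isClosed_iInter fun c => isClosed_iInter fun _ => isClosed_iInter fun v =>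
    isClosed_eq (continuous_apply _) ((continuous_apply v).const_smul c)

variable {𝕜 V W ι : Type*} [RCLike 𝕜] [NormedAddCommGroup V] [NormedSpace 𝕜 V]
  [NormedAddCommGroup W] [NormedSpace 𝕜 W] [Fintype ι]

/-- The weak `1`-norm `sup_{v ∈ B_V} ∑ |x_i v|` of a finite family of functionals is at most `c`.
For `c = 1` this is the constraint on the families which define the norms of `FBL[X]` and
`FBL_ℂ[E]`. -/
def WeakOneNormLE (x : ι → StrongDual 𝕜 V) (c : ℝ) : Prop :=
  ∀ v : V, ‖v‖ ≤ 1 → ∑ i, ‖x i v‖ ≤ c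

namespace WeakOneNormLE

theorem nonneg {x : ι → StrongDual 𝕜 V} {c : ℝ} (hx : WeakOneNormLE x c) : 0 ≤ c :=
  (Finset.sum_nonneg fun i _ => norm_nonneg (x i 0)).trans (hx 0 (norm_zero.trans_le zero_le_one))

theorem sum_norm_apply_le {x : ι → StrongDual 𝕜 V} {c : ℝ} (hx : WeakOneNormLE x c) (v : V) :
    ∑ i, ‖x i v‖ ≤ c * ‖v‖ := by
  rcases eq_or_ne v 0 with rfl | hv
  · simp
  · have h := hx ((‖v‖⁻¹ : 𝕜) • v) (norm_smul_inv_norm hv).le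
    simp only [map_smul, norm_smul, norm_inv, RCLike.norm_ofReal, abs_norm,
      ← Finset.mul_sum] at h
    rwa [inv_mul_le_iff₀ (norm_pos_iff.2 hv), mul_comm] at h

theorem eq_zero {x : ι → StrongDual 𝕜 V} (hx : WeakOneNormLE x 0) : x = 0 := by
  ext i v
  have hsum : ∑ i, ‖x i v‖ ≤ 0 := by simpa only [zero_mul] using hx.sum_norm_apply_le v
  exact norm_le_zero_iff.1
    ((Finset.single_le_sum (fun i _ => norm_nonneg (x i v)) (Finset.mem_univ i)).trans hsum)

theorem of_norm_le {w : StrongDual 𝕜 V} {c : ℝ} (hw : ‖w‖ ≤ c) :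
    WeakOneNormLE (fun _ : Fin 1 => w) c := fun v hv => by
  rw [Fin.sum_univ_one]
  exact (w.unit_le_opNorm v hv).trans hw

theorem comp {x : ι → StrongDual 𝕜 W} {c : ℝ} (hx : WeakOneNormLE x c) (T : V →L[𝕜] W) :
    WeakOneNormLE (fun i => (x i).comp T) (c * ‖T‖) := fun v hv =>
  (hx.sum_norm_apply_le (T v)).trans
    (mul_le_mul_of_nonneg_left (T.unit_le_opNorm v hv) hx.nonneg)

theorem inv_smul {x : ι → StrongDual 𝕜 V} {c : ℝ} (hx : WeakOneNormLE x c) :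
    WeakOneNormLE (fun i => c⁻¹ • x i) 1 := fun v hv =>
  have hc : 0 ≤ c⁻¹ := inv_nonneg.2 hx.nonneg
  calc ∑ i, ‖c⁻¹ • x i v‖ = c⁻¹ * ∑ i, ‖x i v‖ := by
        simp only [norm_smul, Real.norm_of_nonneg hc, Finset.mul_sum]
    _ ≤ c⁻¹ * c := mul_le_mul_of_nonneg_left (hx v hv) hc
    _ ≤ 1 := inv_mul_le_one

end WeakOneNormLE

theorem PosHomogeneous.sum_enorm_le {Z : Type*} [NormedAddCommGroup Z] [NormedSpace ℝ Z]
    {f : StrongDual 𝕜 V → Z} (hf : PosHomogeneous f) {C : ℝ≥0∞}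
    (hC : ∀ y : ι → StrongDual 𝕜 V, WeakOneNormLE y 1 → ∑ i, ‖f (y i)‖ₑ ≤ C)
    {x : ι → StrongDual 𝕜 V} {c : ℝ} (hx : WeakOneNormLE x c) :
    ∑ i, ‖f (x i)‖ₑ ≤ ENNReal.ofReal c * C := by
  have hc : 0 ≤ c := hx.nonneg
  have hscale : ∀ i, c • c⁻¹ • x i = x i := fun i => by
    rcases hc.eq_or_lt with rfl | hc'
    · exact (zero_smul ℝ _).trans (congrFun hx.eq_zero i).symm
    · exact smul_inv_smul₀ hc'.ne' (x i)
  calc ∑ i, ‖f (x i)‖ₑ = ENNReal.ofReal c * ∑ i, ‖f (c⁻¹ • x i)‖ₑ := by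
        rw [Finset.mul_sum]
        refine Finset.sum_congr rfl fun i _ => ?_
        rw [← Real.enorm_of_nonneg hc, ← enorm_smul, ← hf c hc, hscale]
    _ ≤ ENNReal.ofReal c * C := by gcongr; exact hC _ hx.inv_smul

end WeakOneNorm

section Real

variable {X Y : Type*} [NormedAddCommGroup X] [NormedSpace ℝ X] [NormedAddCommGroup Y]
  [NormedSpace ℝ Y]

theorem posHomogeneous_of_mem_FBL {f : StrongDual ℝ X → ℝ} (hf : f ∈ FBL X) : PosHomogeneous f :=
  (isClosedSublattice_FBL.le_H₁ hf).1

theorem realENorm_lt_top_of_mem_FBL {f : StrongDual ℝ X → ℝ} (hf : f ∈ FBL X) :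
    realENorm X f < ∞ :=
  (isClosedSublattice_FBL.le_H₁ hf).2

theorem mem_FBL_of_approx {f : StrongDual ℝ X → ℝ} (hf : PosHomogeneous f)
    (happrox : ∀ ε : ℝ≥0∞, 0 < ε → ∃ g ∈ FBL X, realENorm X (f - g) < ε) : f ∈ FBL X := by
  refine isClosedSublattice_FBL.closed f ⟨hf, ?_⟩ happrox
  obtain ⟨g, hg, hfg⟩ := happrox 1 one_pos
  calc realENorm X f = realENorm X ((f - g) + g) := by rw [sub_add_cancel]
    _ ≤ realENorm X (f - g) + realENorm X g := realENorm_add_le _ _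
    _ < ∞ := ENNReal.add_lt_top.2
      ⟨hfg.trans ENNReal.one_lt_top, realENorm_lt_top_of_mem_FBL hg⟩

/-- The evaluation `δ_x` as an element of `FBL[X]`. -/
def evalFBL (x : X) : FBL X := ⟨evalFn x, evalFn_mem_FBL x⟩

theorem eq_top_of_evalFBL_mem {S : Submodule ℝ (FBL X)} (heval : ∀ x, evalFBL x ∈ S)
    (hsup : ∀ f ∈ S, ∀ g ∈ S, f ⊔ g ∈ S)
    (hclosed : ∀ f : FBL X,
      (∀ ε : ℝ≥0∞, 0 < ε → ∃ g ∈ S, realENorm X (f.1 - g.1) < ε) → f ∈ S) : S = ⊤ := by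
  have hlattice : IsClosedSublattice (S.map (FBL X).subtype) :=
    { le_H₁ := (Submodule.map_subtype_le _ _).trans isClosedSublattice_FBL.le_H₁
      sup_mem := by
        rintro _ ⟨f, hf, rfl⟩ _ ⟨g, hg, rfl⟩
        exact ⟨f ⊔ g, hsup f hf g hg, rfl⟩
      closed := by
        intro f hf happrox
        have hfFBL : f ∈ FBL X := isClosedSublattice_FBL.closed f hf fun ε hε => by
          obtain ⟨_, ⟨g, -, rfl⟩, hfg⟩ := happrox ε hε
          exact ⟨g, g.2, hfg⟩
        refine ⟨⟨f, hfFBL⟩, hclosed _ fun ε hε => ?_, rfl⟩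
        obtain ⟨_, ⟨g, hg, rfl⟩, hfg⟩ := happrox ε hε
        exact ⟨g, hg, hfg⟩ }
  have hle : FBL X ≤ S.map (FBL X).subtype :=
    sInf_le ⟨hlattice, fun x => ⟨evalFBL x, heval x, rfl⟩⟩
  refine (Submodule.eq_top_iff').2 fun f => ?_
  obtain ⟨g, hg, hgf⟩ := hle f.2
  rwa [← Subtype.ext hgf]

/-- The pullback `f ↦ f ∘ T*` along the adjoint of `T`, on arbitrary functions. -/
def pullback (T : X →L[ℝ] Y) : (StrongDual ℝ X → ℝ) →ₗ[ℝ] (StrongDual ℝ Y → ℝ) :=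
  LinearMap.funLeft ℝ ℝ fun φ : StrongDual ℝ Y => φ.comp T

theorem realENorm_pullback_le (T : X →L[ℝ] Y) {f : StrongDual ℝ X → ℝ} (hf : PosHomogeneous f) :
    realENorm Y (pullback T f) ≤ ENNReal.ofReal ‖T‖ * realENorm X f :=
  realENorm_le fun _ x (hx : WeakOneNormLE x 1) =>
    hf.sum_enorm_le (sum_le_realENorm f) (by simpa only [one_mul] using hx.comp T)

theorem posHomogeneous_pullback (T : X →L[ℝ] Y) {f : StrongDual ℝ X → ℝ}
    (hf : PosHomogeneous f) : PosHomogeneous (pullback T f) :=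
  fun c hc φ => hf c hc (φ.comp T)

theorem pullback_mem_FBL (T : X →L[ℝ] Y) {f : StrongDual ℝ X → ℝ} (hf : f ∈ FBL X) :
    pullback T f ∈ FBL Y := by
  have htop : (FBL Y).comap (pullback T ∘ₗ (FBL X).subtype) = ⊤ := by
    refine eq_top_of_evalFBL_mem (fun x => evalFn_mem_FBL (T x))
      (fun f hf g hg => isClosedSublattice_FBL.sup_mem _ hf _ hg) fun f happrox => ?_
    refine mem_FBL_of_approx (posHomogeneous_pullback T (posHomogeneous_of_mem_FBL f.2))
      fun ε hε => ?_
    obtain ⟨g, hg, hfg⟩ := happrox (ε / ENNReal.ofReal ‖T‖)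
      (ENNReal.div_pos hε.ne' ENNReal.ofReal_ne_top)
    refine ⟨pullback T g, hg, ?_⟩
    calc realENorm Y (pullback T f - pullback T g)
        ≤ ENNReal.ofReal ‖T‖ * realENorm X (f.1 - g.1) := by
          rw [← map_sub]
          exact realENorm_pullback_le T (posHomogeneous_of_mem_FBL (f - g).2)
      _ < ε := by rw [mul_comm]; exact ENNReal.mul_lt_of_lt_div hfg
  exact htop.ge (Submodule.mem_top (x := (⟨f, hf⟩ : FBL X)))

/-- The lattice homomorphism `FBL[X] → FBL[Y]`, `f ↦ f ∘ T*`, induced by `T`. -/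
def inducedReal (T : X →L[ℝ] Y) : FBL X →ₗ[ℝ] FBL Y :=
  (pullback T).restrict fun _ => pullback_mem_FBL T

end Real

section Complex

variable {E F : Type*} [NormedAddCommGroup E] [NormedSpace ℂ E] [NormedAddCommGroup F]
  [NormedSpace ℂ F]

theorem rePart_smul (c : ℝ) (z : StrongDual ℂ E) : rePart (c • z) = c • rePart z := by
  ext v
  exact Complex.smul_re c (z v)

theorem rePart_extendRCLike (φ : StrongDual ℝ E) :
    rePart (StrongDual.extendRCLike (𝕜 := ℂ) φ) = φ :=
  ContinuousLinearMap.ext (StrongDual.re_extendRCLike_apply (𝕜 := ℂ) φ)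

theorem WeakOneNormLE.rePart {ι : Type*} [Fintype ι] {z : ι → StrongDual ℂ E} {c : ℝ}
    (hz : WeakOneNormLE z c) : WeakOneNormLE (fun i => rePart (z i)) c := fun v hv =>
  (Finset.sum_le_sum fun i _ => Complex.abs_re_le_norm (z i v)).trans (hz v hv)

theorem WeakOneNormLE.extendRCLike {ι : Type*} [Fintype ι] {x : ι → StrongDual ℝ E}
    {c : ℝ} (hx : WeakOneNormLE x c) :
    WeakOneNormLE (fun i => StrongDual.extendRCLike (𝕜 := ℂ) (x i)) (2 * c) := fun v hv =>
  calc ∑ i, ‖StrongDual.extendRCLike (𝕜 := ℂ) (x i) v‖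
      ≤ ∑ i, (‖x i v‖ + ‖x i (Complex.I • v)‖) := by
        refine Finset.sum_le_sum fun i _ => (Complex.norm_le_abs_re_add_abs_im _).trans_eq ?_
        have hre : (StrongDual.extendRCLike (𝕜 := ℂ) (x i) v).re = x i v :=
          StrongDual.re_extendRCLike_apply (𝕜 := ℂ) (x i) v
        have him : (StrongDual.extendRCLike (𝕜 := ℂ) (x i) v).im = -x i (Complex.I • v) :=
          StrongDual.im_extendRCLike_apply (𝕜 := ℂ) (x i) v
        rw [hre, him, abs_neg, Real.norm_eq_abs, Real.norm_eq_abs]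
    _ = ∑ i, ‖x i v‖ + ∑ i, ‖x i (Complex.I • v)‖ := Finset.sum_add_distrib
    _ ≤ c + c := add_le_add (hx v hv) (hx _ (by rwa [norm_smul, Complex.norm_I, one_mul]))
    _ = 2 * c := (two_mul c).symm

theorem PosHomogeneous.comp_rePart {h : StrongDual ℝ E → ℂ} (hh : PosHomogeneous h) :
    PosHomogeneous fun z : StrongDual ℂ E => h (rePart z) := fun c hc z => by
  simp only [rePart_smul, hh c hc]

theorem PosHomogeneous.sum_enorm_le_complexENorm {h : StrongDual ℝ E → ℂ}
    (hh : PosHomogeneous h) {m : ℕ} {z : Fin m → StrongDual ℂ E} {c : ℝ}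
    (hz : WeakOneNormLE z c) :
    ∑ j, ‖h (rePart (z j))‖ₑ ≤ ENNReal.ofReal c * complexENorm h :=
  hh.comp_rePart.sum_enorm_le (sum_le_complexENorm h) hz

theorem complexENorm_le_realENorm {f : StrongDual ℝ E → ℝ} {h : StrongDual ℝ E → ℂ}
    (hhf : ∀ φ, ‖h φ‖ₑ ≤ ‖f φ‖ₑ) : complexENorm h ≤ realENorm E f :=
  complexENorm_le fun _ _ hz => (Finset.sum_le_sum fun _ _ => hhf _).trans
    (sum_le_realENorm f _ (WeakOneNormLE.rePart hz))

theorem realENorm_le_two_mul_complexENorm {f : StrongDual ℝ E → ℝ} {h : StrongDual ℝ E → ℂ}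
    (hh : PosHomogeneous h) (hfh : ∀ φ, ‖f φ‖ₑ ≤ ‖h φ‖ₑ) :
    realENorm E f ≤ 2 * complexENorm h := by
  refine realENorm_le fun n x hx => ?_
  calc ∑ i, ‖f (x i)‖ₑ ≤ ∑ i, ‖h (rePart (StrongDual.extendRCLike (𝕜 := ℂ) (x i)))‖ₑ :=
        Finset.sum_le_sum fun i _ => by rw [rePart_extendRCLike]; exact hfh (x i)
    _ ≤ ENNReal.ofReal (2 * 1) * complexENorm h :=
        hh.sum_enorm_le_complexENorm (WeakOneNormLE.extendRCLike hx)
    _ = 2 * complexENorm h := by rw [mul_one, ENNReal.ofReal_ofNat]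

theorem lowerSemicontinuous_complexENorm :
    LowerSemicontinuous (complexENorm : (StrongDual ℝ E → ℂ) → ℝ≥0∞) :=
  lowerSemicontinuous_iSup fun _ => lowerSemicontinuous_iSup fun _ =>
    lowerSemicontinuous_iSup fun _ => Continuous.lowerSemicontinuous (by fun_prop)

namespace FBLC

theorem exists_eq_mk (h : FBLC E) : ∃ f g : FBL E, h = mk f g :=
  ⟨⟨_, h.2.1⟩, ⟨_, h.2.2⟩, rfl⟩

theorem mk_inj {f g f' g' : FBL E} : mk f g = mk f' g' ↔ f = f' ∧ g = g' := by
  refine ⟨fun h => ?_, by rintro ⟨rfl, rfl⟩; rfl⟩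
  have hfun : ∀ φ, (mk f g).toFun φ = (mk f' g').toFun φ := fun φ => by rw [h]
  exact ⟨Subtype.ext (funext fun φ => congrArg Complex.re (hfun φ)),
    Subtype.ext (funext fun φ => congrArg Complex.im (hfun φ))⟩

theorem posHomogeneous_toFun (h : FBLC E) : PosHomogeneous h.toFun := fun c hc φ =>
  Complex.ext ((posHomogeneous_of_mem_FBL h.2.1 c hc φ).trans (Complex.smul_re c _).symm)
    ((posHomogeneous_of_mem_FBL h.2.2 c hc φ).trans (Complex.smul_im c _).symm)

theorem complexENorm_toFun (h : FBLC E) : complexENorm h.toFun = ENNReal.ofReal ‖h‖ :=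
  (ENNReal.ofReal_toReal (enorm_lt_top h).ne).symm

theorem norm_le_iff {h : FBLC E} {C : ℝ} (hC : 0 ≤ C) :
    ‖h‖ ≤ C ↔ complexENorm h.toFun ≤ ENNReal.ofReal C := by
  rw [complexENorm_toFun, ENNReal.ofReal_le_ofReal_iff hC]

theorem norm_le_of_forall_sum_le {h : FBLC E} {C : ℝ} (hC : 0 ≤ C)
    (hsum : ∀ (m : ℕ) (z : Fin m → StrongDual ℂ E), WeakOneNormLE z 1 →
      ∑ j, ‖h.toFun (rePart (z j))‖ ≤ C) : ‖h‖ ≤ C := by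
  refine (norm_le_iff hC).2 (complexENorm_le fun m z hz => ?_)
  simp only [← ofReal_norm]
  rw [← ENNReal.ofReal_sum_of_nonneg fun _ _ => norm_nonneg _]
  exact ENNReal.ofReal_le_ofReal (hsum m z hz)

theorem sum_norm_toFun_le (h : FBLC E) {m : ℕ} {z : Fin m → StrongDual ℂ E} {c : ℝ}
    (hz : WeakOneNormLE z c) : ∑ j, ‖h.toFun (rePart (z j))‖ ≤ c * ‖h‖ := by
  have hc : 0 ≤ c := hz.nonneg
  have hsum := h.posHomogeneous_toFun.sum_enorm_le_complexENorm hz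
  simp only [← ofReal_norm] at hsum
  rwa [complexENorm_toFun, ← ENNReal.ofReal_mul hc,
    ← ENNReal.ofReal_sum_of_nonneg fun _ _ => norm_nonneg _,
    ENNReal.ofReal_le_ofReal_iff (by positivity)] at hsum

theorem norm_toFun_rePart_le (h : FBLC E) (w : StrongDual ℂ E) :
    ‖h.toFun (rePart w)‖ ≤ ‖w‖ * ‖h‖ := by
  simpa only [Fin.sum_univ_one] using
    h.sum_norm_toFun_le (WeakOneNormLE.of_norm_le le_rfl)

theorem norm_toFun_le (h : FBLC E) (φ : StrongDual ℝ E) : ‖h.toFun φ‖ ≤ ‖φ‖ * ‖h‖ := by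
  simpa only [rePart_extendRCLike, StrongDual.norm_extendRCLike] using
    h.norm_toFun_rePart_le (StrongDual.extendRCLike φ)

/-- The inclusion of `FBL_ℂ[E]` in the functions on `(E_ℝ)*`, which carry the topology of pointwise
convergence, as a continuous linear map. -/
def toFunL : FBLC E →L[ℂ] (StrongDual ℝ E → ℂ) :=
  ContinuousLinearMap.pi fun φ => LinearMap.mkContinuous
    { toFun := fun h => h.toFun φ
      map_add' := fun _ _ => rfl
      map_smul' := fun _ _ => rfl } ‖φ‖ fun h => h.norm_toFun_le φ

theorem mem_FBLCsub_of_approx {h : StrongDual ℝ E → ℂ} (hh : PosHomogeneous h)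
    (happrox : ∀ ε : ℝ≥0∞, 0 < ε → ∃ k : FBLC E, complexENorm (h - k.toFun) < ε) :
    h ∈ FBLCsub E := by
  have hdiff (k : FBLC E) : PosHomogeneous (h - k.toFun) := fun c hc φ => by
    simp only [Pi.sub_apply, hh c hc, k.posHomogeneous_toFun c hc, smul_sub]
  have hpart (ρ : ℂ →L[ℝ] ℝ) (hρ : ∀ w, ‖ρ w‖ₑ ≤ ‖w‖ₑ)
      (hmem : ∀ k : FBLC E, (fun φ => ρ (k.toFun φ)) ∈ FBL E) : (fun φ => ρ (h φ)) ∈ FBL E := by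
    refine mem_FBL_of_approx (fun c hc φ => by rw [hh c hc, map_smul]) fun ε hε => ?_
    obtain ⟨k, hk⟩ := happrox (ε / 2) (ENNReal.half_pos hε.ne')
    refine ⟨_, hmem k, ?_⟩
    calc realENorm E ((fun φ => ρ (h φ)) - fun φ => ρ (k.toFun φ))
        ≤ 2 * complexENorm (h - k.toFun) := realENorm_le_two_mul_complexENorm (hdiff k) fun φ => by
          simp only [Pi.sub_apply, ← map_sub]
          exact hρ _
      _ < ε := by rw [mul_comm]; exact ENNReal.mul_lt_of_lt_div hk
  exact ⟨hpart Complex.reCLM (fun w => enorm_le_iff_norm_le.2 (Complex.abs_re_le_norm w))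
      fun k => k.2.1,
    hpart Complex.imCLM (fun w => enorm_le_iff_norm_le.2 (Complex.abs_im_le_norm w))
      fun k => k.2.2⟩

theorem eventually_complexENorm_sub_le {u : ℕ → FBLC E} (hu : CauchySeq u)
    {h : StrongDual ℝ E → ℂ} (hlim : Tendsto (fun n => (u n).toFun) atTop (𝓝 h)) {ε : ℝ}
    (hε : 0 < ε) : ∀ᶠ n in atTop, complexENorm (h - (u n).toFun) ≤ ENNReal.ofReal ε := by
  obtain ⟨N, hN⟩ := Metric.cauchySeq_iff.1 hu ε hε
  filter_upwards [eventually_ge_atTop N] with n hn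
  refine (lowerSemicontinuous_complexENorm.isClosed_preimage _).mem_of_tendsto
    (hlim.sub_const (u n).toFun) ?_
  filter_upwards [eventually_ge_atTop N] with m hm
  exact (norm_le_iff (h := u m - u n) hε.le).1 (by rw [← dist_eq_norm]; exact (hN m hm n hn).le)

instance : CompleteSpace (FBLC E) := by
  refine Metric.complete_of_cauchySeq_tendsto fun u hu => ?_
  obtain ⟨h, hlim⟩ := cauchySeq_tendsto_of_complete (toFunL.uniformContinuous.comp_cauchySeq hu)
  have hh : PosHomogeneous h := isClosed_setOf_posHomogeneous.mem_of_tendsto hlim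
    (Eventually.of_forall fun n => (u n).posHomogeneous_toFun)
  have hmem : h ∈ FBLCsub E := mem_FBLCsub_of_approx hh fun ε hε => by
    obtain ⟨δ, -, hδ, hδε⟩ := ENNReal.lt_iff_exists_real_btwn.1 hε
    obtain ⟨n, hn⟩ := (eventually_complexENorm_sub_le hu hlim (ENNReal.ofReal_pos.1 hδ)).exists
    exact ⟨u n, hn.trans_lt hδε⟩
  let H : FBLC E := ⟨h, hmem⟩
  refine ⟨H, Metric.tendsto_nhds.2 fun ε hε => ?_⟩
  filter_upwards [eventually_complexENorm_sub_le hu hlim (half_pos hε)] with n hn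
  rw [dist_comm, dist_eq_norm]
  exact ((norm_le_iff (h := H - u n) (half_pos hε).le).2 hn).trans_lt (half_lt_self hε)

theorem toFun_delta_rePart (z : E) (w : StrongDual ℂ E) : (delta z).toFun (rePart w) = w z := by
  refine Complex.ext rfl ?_
  change -(w (Complex.I • z)).re = (w z).im
  rw [map_smul, smul_eq_mul, Complex.I_mul_re, neg_neg]

theorem norm_delta (z : E) : ‖delta z‖ = ‖z‖ := by
  refine le_antisymm (norm_le_of_forall_sum_le (norm_nonneg z) fun m w hw => ?_) ?_
  · simpa only [toFun_delta_rePart, one_mul] using hw.sum_norm_apply_le z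
  · obtain ⟨w, hw, hwz⟩ := exists_dual_vector'' ℂ z
    calc ‖z‖ = ‖(delta z).toFun (rePart w)‖ := by
          rw [toFun_delta_rePart, hwz, RCLike.norm_ofReal, abs_norm]
      _ ≤ ‖w‖ * ‖delta z‖ := norm_toFun_rePart_le _ w
      _ ≤ ‖delta z‖ := mul_le_of_le_one_left (norm_nonneg _) hw

/-- The canonical embedding `δ_E` as a linear isometry. -/
def deltaLI : E →ₗᵢ[ℂ] FBLC E := ⟨delta, norm_delta⟩

/-- The operator `FBL_ℂ[E] → FBL_ℂ[F]`, `h ↦ h ∘ T*`, induced by `T`. -/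
def induced (T : E →L[ℂ] F) : FBLC E →L[ℂ] FBLC F :=
  LinearMap.mkContinuous
    { toFun := fun h => ⟨fun φ => h.toFun (φ.comp (T.restrictScalars ℝ)),
        pullback_mem_FBL (T.restrictScalars ℝ) h.2.1, pullback_mem_FBL (T.restrictScalars ℝ) h.2.2⟩
      map_add' := fun _ _ => rfl
      map_smul' := fun _ _ => rfl } ‖T‖ fun h => by
    refine norm_le_of_forall_sum_le (by positivity) fun m z hz => ?_
    have hsum := h.sum_norm_toFun_le (hz.comp T)
    rwa [one_mul] at hsum

theorem toFun_induced_rePart (T : E →L[ℂ] F) (h : FBLC E) (w : StrongDual ℂ F) :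
    (induced T h).toFun (rePart w) = h.toFun (rePart (w.comp T)) := rfl

theorem induced_delta (T : E →L[ℂ] F) (z : E) : induced T (delta z) = delta (T z) := by
  refine toFun_injective (funext fun φ => Complex.ext rfl ?_)
  change -φ (T (Complex.I • z)) = -φ (Complex.I • T z)
  rw [map_smul]

theorem norm_induced (T : E →L[ℂ] F) : ‖induced T‖ = ‖T‖ := by
  refine le_antisymm (LinearMap.mkContinuous_norm_le _ (norm_nonneg T) _)
    (T.opNorm_le_bound (norm_nonneg _) fun z => ?_)
  rw [← norm_delta, ← induced_delta, ← norm_delta z]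
  exact (induced T).le_opNorm _

/-- The map `T ↦ T̄` on operators of `E`, as a homomorphism of multiplicative monoids. -/
def inducedHom : (E →L[ℂ] E) →* (FBLC E →L[ℂ] FBLC E) where
  toFun := induced
  map_one' := rfl
  map_mul' _ _ := rfl

theorem isInduced_induced (T : E →L[ℂ] E) : IsInduced T (induced T) :=
  ⟨⟨inducedReal (T.restrictScalars ℝ), fun _ _ => rfl, fun _ _ => rfl, fun _ _ => rfl⟩,
    induced_delta T⟩

theorem norm_mk_zero_sub_lt {f g : FBL E} {ε : ℝ}
    (hfg : realENorm E (f.1 - g.1) < ENNReal.ofReal ε) : ‖mk f 0 - mk g 0‖ < ε := by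
  refine ENNReal.toReal_lt_of_lt_ofReal ((complexENorm_le_realENorm fun φ => ?_).trans_lt hfg)
  have hreal : (mk f 0 - mk g 0).toFun φ = ((f.1 φ - g.1 φ : ℝ) : ℂ) :=
    (Complex.ofReal_sub (f.1 φ) (g.1 φ)).symm
  rw [hreal]
  exact enorm_le_iff_norm_le.2 (Complex.norm_real _).le

theorem IsLatticeHom.ext {R R' : FBLC E →L[ℂ] FBLC E} (hR : IsLatticeHom R)
    (hR' : IsLatticeHom R') (hdelta : ∀ z, R (delta z) = R' (delta z)) : R = R' := by
  obtain ⟨S, hsup, -, hS⟩ := hR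
  obtain ⟨S', hsup', -, hS'⟩ := hR'
  have hagree (f : FBL E) : S f = S' f ↔ R (mk f 0) = R' (mk f 0) := by
    rw [hS, hS', mk_inj, map_zero, map_zero, and_iff_left rfl]
  have hclosed : IsClosed {k | R k = R' k} := isClosed_eq R.continuous R'.continuous
  have hSS' : S = S' := LinearMap.eqLocus_eq_top.1 <| by
    refine eq_top_of_evalFBL_mem (fun x => ?_) (fun f hf g hg => ?_) fun f happrox => ?_
    · exact (mk_inj.1 ((hS _ _).symm.trans ((hdelta x).trans (hS' _ _)))).1
    · rw [LinearMap.mem_eqLocus] at hf hg ⊢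
      rw [hsup, hsup', hf, hg]
    · refine (hagree f).2 (hclosed.closure_subset (Metric.mem_closure_iff.2 fun ε hε => ?_))
      obtain ⟨g, hg, hfg⟩ := happrox (ENNReal.ofReal ε) (ENNReal.ofReal_pos.2 hε)
      exact ⟨mk g 0, (hagree g).1 hg, by rw [dist_eq_norm]; exact norm_mk_zero_sub_lt hfg⟩
  ext k : 1
  obtain ⟨f, g, rfl⟩ := exists_eq_mk k
  rw [hS, hS', hSS']

theorem IsInduced.eq_induced {T : E →L[ℂ] E} {R : FBLC E →L[ℂ] FBLC E} (hR : IsInduced T R) :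
    R = induced T :=
  hR.1.ext (isInduced_induced T).1 fun z => (hR.2 z).trans (induced_delta T z).symm

theorem antilipschitz_of_antilipschitz_induced {T : E →L[ℂ] F}
    (h : ∃ K, AntilipschitzWith K (induced T)) : ∃ K, AntilipschitzWith K T := by
  rw [antilipschitzWith_iff_exists_mul_le_norm] at h ⊢
  obtain ⟨c, hc, hbelow⟩ := h
  exact ⟨c, hc, fun z => by simpa only [induced_delta, norm_delta] using hbelow (delta z)⟩

theorem topologicalClosure_range_eq_top_of_surjective_induced {T : E →L[ℂ] F}
    (hsurj : Function.Surjective (induced T)) : T.range.topologicalClosure = ⊤ := by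
  refine topologicalClosure_eq_top_of_forall_dual fun w hw => ?_
  have hwT : w.comp T = 0 := ContinuousLinearMap.ext fun z => hw (T z) ⟨z, rfl⟩
  ext v
  obtain ⟨k, hk⟩ := hsurj (delta v)
  have hzero : ‖k.toFun (rePart (w.comp T))‖ ≤ 0 := by
    simpa only [hwT, norm_zero, zero_mul] using k.norm_toFun_rePart_le (w.comp T)
  rw [← toFun_delta_rePart, ← hk, toFun_induced_rePart]
  exact norm_le_zero_iff.1 hzero

theorem isUnit_induced_iff [CompleteSpace E] {T : E →L[ℂ] E} :
    IsUnit (induced T) ↔ IsUnit T := by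
  refine ⟨fun h => ?_, fun h => h.map inducedHom⟩
  rw [ContinuousLinearMap.isUnit_iff_bijective] at h ⊢
  have hanti := ((induced T).bijective_iff_dense_range_and_antilipschitz.1 h).2
  exact T.bijective_iff_dense_range_and_antilipschitz.2
    ⟨topologicalClosure_range_eq_top_of_surjective_induced h.2,
      antilipschitz_of_antilipschitz_induced hanti⟩

end FBLC

end Complex

end FreeBanachLattice

end

open FreeBanachLattice in
theorem propositionp {E : Type*} [NormedAddCommGroup E] [NormedSpace ℂ E] [CompleteSpace E]
    (T : E →L[ℂ] E) :
    ∃ Tbar : FBLC E →L[ℂ] FBLC E,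
      (FBLC.IsInduced T Tbar ∧ ∀ R : FBLC E →L[ℂ] FBLC E, FBLC.IsInduced T R → R = Tbar) ∧
      ‖Tbar‖ = ‖T‖ ∧
      approxPointSpectrum T ⊆ approxPointSpectrum Tbar ∧
      pointSpectrum T ⊆ pointSpectrum Tbar ∧
      ((0 : ℂ) ∈ spectrum ℂ T ↔ (0 : ℂ) ∈ spectrum ℂ Tbar) ∧
      spectralRadius ℂ Tbar = spectralRadius ℂ T := by
  refine ⟨FBLC.induced T, ⟨FBLC.isInduced_induced T, fun R hR => hR.eq_induced⟩,
    FBLC.norm_induced T, ?_, ?_, ?_, ?_⟩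
  · exact approxPointSpectrum_subset FBLC.deltaLI (FBLC.induced_delta T)
  · exact pointSpectrum_subset FBLC.deltaLI.injective (FBLC.induced_delta T)
  · rw [spectrum.zero_mem_iff, spectrum.zero_mem_iff, FBLC.isUnit_induced_iff]
  · exact spectralRadius_map_of_norm_map (φ := FBLC.inducedHom) FBLC.norm_induced T
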